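/- Let $\Omega\subset\mathbb{R}^d$ be a bounded Lipschitz domain with $\partial\Omega=\bar\Gamma_D\cup\bar\Gamma_N$, $\Gamma_D\cap\Gamma_N=\emptyset$, and let $q_{\rm in},q_{\rm out}\in L^2(\Gamma_N)^d$. Let $E_{\max},E_{\min}>0$ and let $E_0$ be a constant elasticity tensor, i.e. a symmetric positive definite linear map on the symmetric $d\times d$ matrices. For $\beta\in(0,1)$ let $$\mathcal U=\Big\{\chi\in BV(\Omega):\ \chi\in\{0,1\}\ \text{a.e.},\ \int_\Omega\chi\,dx\le\beta|\Omega|\Big\},\qquad E^{-1}(\chi)=\Big(\Big(\frac1{E_{\max}}-\frac1{E_{\min}}\Big)\chi+\frac1{E_{\min}}\Big)E_0^{-1},$$ and let $S$ be the set of pairs $(\sigma,\varrho)$ of symmetric tensor fields in $L^2(\Omega)^{d\times d}$ with $\nabla\cdot\sigma=\nabla\cdot\varrho=0$ in the sense of distributions and with normal traces $\sigma\cdot\vec n=q_{\rm in}$, $\varrho\cdot\vec n=q_{\rm out}$ on $\Gamma_N$ (in the weak sense given by Green's formula, tested with the fields $w\in H^1(\Omega)^d$ whose trace vanishes on $\partial\Omega\setminus\Gamma_N$).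 Put $$\tilde J(\chi,\sigma,\varrho)=\int_\Omega E^{-1}(\chi)\sigma:\varrho\,dx,\qquad \tilde g(\chi,\sigma,\varrho)=\int_\Omega E^{-1}(\chi)(\sigma:\sigma+\varrho:\varrho)\,dx,$$ $$L(\chi,\sigma,\varrho)=\tilde J(\chi,\sigma,\varrho)+\lambda\Big(\tilde g(\chi,\sigma,\varrho)-\min_{(\hat\sigma,\hat\varrho)\in S}\tilde g(\chi,\hat\sigma,\hat\varrho)\Big).$$ Suppose $\lambda>1/2$. Then: 1. For every $\chi\in\mathcal U$: if $S\neq\emptyset$, then $\tilde g(\chi,\cdot,\cdot)$ has exactly one minimizer over $S$. Whenever $(\sigma^*,\varrho^*)\in\arg\min_{S}\tilde g(\chi,\cdot,\cdot)$, the functional $L(\chi,\cdot,\cdot)$ attains its minimum over $S$, exactly at $(\sigma^*,\varrho^*)$, and $$\min_{(\hat\sigma,\hat\varrho)\in S}L(\chi,\hat\sigma,\hat\varrho)=\tilde J(\chi,\sigma^*,\varrho^*).$$ 2. The single-level penalty problem $\min_{(\chi,\sigma,\varrho)\in\mathcal U\times S}L(\chi,\sigma,\varrho)$ is equivalent to the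 bilevel problem of minimizing $\tilde J(\chi,\sigma,\varrho)$ over the triples with $\chi\in\mathcal U$ and $(\sigma,\varrho)\in\arg\min_{S}\tilde g(\chi,\cdot,\cdot)$: the two problems have the same set of minimizers and the same infimum (a real number is the greatest lower bound of the values of one objective iff it is that of the other). -/

import Mathlib

open MeasureTheory Set Filter Topology
open scoped ContDiff

noncomputable section

namespace Mechanism

/-- The space `ℝ^d` with its Euclidean structure. -/
abbrev Space (d : ℕ) : Type := EuclideanSpace ℝ (Fin d)

/-- Bounded Lipschitz domain: a bounded, open, connected, nonempty set which near each boundary point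
is the strict epigraph of a Lipschitz function in suitable Cartesian coordinates.  The unit vector `e`
is the last coordinate direction, `x - ⟪e, x⟫ e` collects the remaining coordinates of `x`. -/
def IsLipschitzDomain {d : ℕ} (Ω : Set (Space d)) : Prop :=
  IsOpen Ω ∧ IsConnected Ω ∧ Bornology.IsBounded Ω ∧
    ∀ z ∈ frontier Ω, ∃ r : ℝ, 0 < r ∧ ∃ e : Space d, ‖e‖ = 1 ∧
      ∃ (K : NNReal) (γ : Space d → ℝ), LipschitzWith K γ ∧
        ∀ x ∈ Metric.ball z r, (x ∈ Ω ↔ γ (x - (inner ℝ e x) • e) < inner ℝ e x)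

/-- The surface measure on the boundary: the normalised `(d-1)`-dimensional Hausdorff measure. -/
def surface {d : ℕ} (Ω : Set (Space d)) : Measure (Space d) :=
  (Measure.euclideanHausdorffMeasure (d - 1)).restrict (frontier Ω)

/-- `L²(Ω)`. -/
abbrev L2 {d : ℕ} (Ω : Set (Space d)) : Type := Lp ℝ 2 ((volume : Measure (Space d)).restrict Ω)

/-- `L²(∂Ω)`. -/
abbrev L2Boundary {d : ℕ} (Ω : Set (Space d)) : Type := Lp ℝ 2 (surface Ω)

/-- `L²(Γ)^d` for a part `Γ` of the boundary of `Ω`. -/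
abbrev Traction {d : ℕ} (Ω Γ : Set (Space d)) : Type :=
  Fin d → Lp ℝ 2 ((surface Ω).restrict Γ)

/-- `L²(Ω)^{d × d}`. -/
abbrev TensorField {d : ℕ} (Ω : Set (Space d)) : Type := Matrix (Fin d) (Fin d) (L2 Ω)

/-- Classical partial derivative. -/
def partialDeriv {d : ℕ} (i : Fin d) (φ : Space d → ℝ) (x : Space d) : ℝ :=
  fderiv ℝ φ x (EuclideanSpace.single i 1)

/-- `φ ∈ C_c^∞(Ω)`. -/
def IsTestFunction {d : ℕ} (Ω : Set (Space d)) (φ : Space d → ℝ) : Prop :=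
  ContDiff ℝ ∞ φ ∧ HasCompactSupport φ ∧ tsupport φ ⊆ Ω

/-- `w ∈ H¹(Ω)` with weak gradient `g`. -/
def HasWeakGradient {d : ℕ} (Ω : Set (Space d)) (w : L2 Ω) (g : Fin d → L2 Ω) : Prop :=
  ∀ φ : Space d → ℝ, IsTestFunction Ω φ → ∀ i : Fin d,
    ∫ x in Ω, w x * partialDeriv i φ x = -∫ x in Ω, g i x * φ x

/-- `t ∈ L²(∂Ω)` is the boundary trace of the `H¹(Ω)` function `w` with weak gradient `g`: the trace
operator is the closure, from `H¹(Ω)` to `L²(∂Ω)`, of the restriction to `∂Ω` of functions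
that are smooth up to the boundary. -/
def HasTrace {d : ℕ} (Ω : Set (Space d)) (w : L2 Ω) (g : Fin d → L2 Ω) (t : L2Boundary Ω) : Prop :=
  ∃ φ : ℕ → Space d → ℝ, (∀ n, ContDiff ℝ ∞ (φ n)) ∧
    Tendsto (fun n => eLpNorm (fun x => φ n x - w x) 2 (volume.restrict Ω)) atTop (𝓝 0) ∧
    (∀ i, Tendsto (fun n => eLpNorm (fun x => partialDeriv i (φ n) x - g i x) 2
      (volume.restrict Ω)) atTop (𝓝 0)) ∧
    Tendsto (fun n => eLpNorm (fun x => φ n x - t x) 2 (surface Ω)) atTop (𝓝 0)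

/-- The distributional (row-wise) divergence of `σ` on `Ω` is `f ∈ L²(Ω)^d`. -/
def HasWeakDivergence {d : ℕ} (Ω : Set (Space d)) (σ : TensorField Ω) (f : Fin d → L2 Ω) : Prop :=
  ∀ φ : Space d → ℝ, IsTestFunction Ω φ → ∀ i : Fin d,
    ∫ x in Ω, ∑ j, σ i j x * partialDeriv j φ x = -∫ x in Ω, f i x * φ x

/-- `σ · n = q` on `Γ`, for `σ ∈ H(div; Ω)` with divergence `f`.  The normal trace of `σ` is the
functional on boundary traces of vector fields `w ∈ H¹(Ω)^d` given by Green's formula,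
`w ↦ ∫_Ω σ : ∇w + ∫_Ω f · w`; its restriction to `Γ` is tested with the `w` whose trace vanishes
(almost everywhere) on `∂Ω` outside `Γ`. -/
def HasNormalTraceOn {d : ℕ} (Ω Γ : Set (Space d)) (σ : TensorField Ω) (f : Fin d → L2 Ω)
    (q : Traction Ω Γ) : Prop :=
  ∀ (w : Fin d → L2 Ω) (G : Fin d → Fin d → L2 Ω) (t : Fin d → L2Boundary Ω),
    (∀ i, HasWeakGradient Ω (w i) (G i)) → (∀ i, HasTrace Ω (w i) (G i) (t i)) →
    (∀ i, ∀ᵐ x ∂(surface Ω), x ∉ Γ → t i x = 0) →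
    (∫ x in Ω, ∑ i, ∑ j, σ i j x * G i j x) + (∫ x in Ω, ∑ i, f i x * w i x) =
      ∫ x in Γ, ∑ i, q i x * t i x ∂(surface Ω)

/-- Symmetric, divergence free stress fields in `L²(Ω)^{d × d}` with `σ · n = q` on `Γ`. -/
def stressSet {d : ℕ} (Ω Γ : Set (Space d)) (q : Traction Ω Γ) : Set (TensorField Ω) :=
  {σ | (∀ i j, σ i j = σ j i) ∧ HasWeakDivergence Ω σ 0 ∧ HasNormalTraceOn Ω Γ σ 0 q}

/-- The set `S` of admissible pairs of stress fields. -/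
def stressPairs {d : ℕ} (Ω Γ : Set (Space d)) (qin qout : Traction Ω Γ) :
    Set (TensorField Ω × TensorField Ω) :=
  stressSet Ω Γ qin ×ˢ stressSet Ω Γ qout

/-- `L¹(Ω)`. -/
abbrev L1 {d : ℕ} (Ω : Set (Space d)) : Type := Lp ℝ 1 ((volume : Measure (Space d)).restrict Ω)

/-- `χ ∈ BV(Ω)`: the total variation of the integrable function `χ` in `Ω` is finite. -/
def IsBV {d : ℕ} (Ω : Set (Space d)) (χ : L1 Ω) : Prop :=
  ∃ M : ℝ, ∀ φ : Fin d → Space d → ℝ, (∀ i, IsTestFunction Ω (φ i)) →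
    (∀ x, ∑ i, φ i x ^ 2 ≤ 1) → ∫ x in Ω, χ x * ∑ i, partialDeriv i (φ i) x ≤ M

/-- The set `𝒰` of admissible densities. -/
def designs {d : ℕ} (Ω : Set (Space d)) (β : ℝ) : Set (L1 Ω) :=
  {χ | IsBV Ω χ ∧ (∀ᵐ x ∂(volume.restrict Ω), χ x = 0 ∨ χ x = 1) ∧
    ∫ x in Ω, χ x ≤ β * volume.real Ω}

/-- Symmetric `d × d` matrices. -/
def symMat (d : ℕ) : Submodule ℝ (Matrix (Fin d) (Fin d) ℝ) where
  carrier := {M | M.IsSymm}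
  add_mem' ha hb := ha.add hb
  zero_mem' := Matrix.isSymm_zero
  smul_mem' c _ ha := ha.smul c

/-- The product `A : B = ∑ᵢⱼ Aᵢⱼ Bᵢⱼ`. -/
def frob {d : ℕ} (A B : Matrix (Fin d) (Fin d) ℝ) : ℝ := ∑ i, ∑ j, A i j * B i j

/-- A constant elasticity tensor, acting on symmetric matrices, that is symmetric and positive
definite. -/
def IsElasticityTensor {d : ℕ} (E₀ : symMat d ≃ₗ[ℝ] symMat d) : Prop :=
  (∀ a b : symMat d, frob (E₀ a).1 b.1 = frob a.1 (E₀ b).1) ∧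
    ∀ a : symMat d, a ≠ 0 → 0 < frob (E₀ a).1 a.1

/-- The symmetric part of a matrix (a symmetric matrix is its own symmetric part). -/
def symPart {d : ℕ} (M : Matrix (Fin d) (Fin d) ℝ) : symMat d :=
  ⟨(1 / 2 : ℝ) • (M + M.transpose), by
    change Matrix.IsSymm _
    apply Matrix.IsSymm.smul
    rw [Matrix.IsSymm, Matrix.transpose_add, Matrix.transpose_transpose, add_comm]⟩

theorem symPart_of_isSymm {d : ℕ} {M : Matrix (Fin d) (Fin d) ℝ} (h : M.IsSymm) :
    (symPart M).1 = M := by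
  ext i j
  have := congrFun (congrFun h i) j
  simp only [Matrix.transpose_apply] at this
  simp only [symPart, Matrix.smul_apply, Matrix.add_apply, Matrix.transpose_apply, this, smul_eq_mul]
  ring

/-- The value at `x` of a matrix field. -/
def TensorField.at {d : ℕ} {Ω : Set (Space d)} (σ : TensorField Ω) (x : Space d) :
    Matrix (Fin d) (Fin d) ℝ := fun i j => σ i j x

/-- `E⁻¹(c) M = ((1/E_max - 1/E_min) c + 1/E_min) E₀⁻¹ M` for a density value `c` and a symmetric
matrix `M`. -/
def compliance {d : ℕ} (Emax Emin : ℝ) (E₀ : symMat d ≃ₗ[ℝ] symMat d) (c : ℝ)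
    (M : Matrix (Fin d) (Fin d) ℝ) : Matrix (Fin d) (Fin d) ℝ :=
  ((1 / Emax - 1 / Emin) * c + 1 / Emin) • (E₀.symm (symPart M)).1

/-- `J̃(χ, σ, ϱ) = ∫_Ω E⁻¹(χ) σ : ϱ dx`. -/
def Jtilde {d : ℕ} {Ω : Set (Space d)} (Emax Emin : ℝ) (E₀ : symMat d ≃ₗ[ℝ] symMat d)
    (χ : L1 Ω) (p : TensorField Ω × TensorField Ω) : ℝ :=
  ∫ x in Ω, frob (compliance Emax Emin E₀ (χ x) (p.1.at x)) (p.2.at x)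

/-- `g̃(χ, σ, ϱ) = ∫_Ω E⁻¹(χ) (σ : σ + ϱ : ϱ) dx`. -/
def gtilde {d : ℕ} {Ω : Set (Space d)} (Emax Emin : ℝ) (E₀ : symMat d ≃ₗ[ℝ] symMat d)
    (χ : L1 Ω) (p : TensorField Ω × TensorField Ω) : ℝ :=
  ∫ x in Ω, (frob (compliance Emax Emin E₀ (χ x) (p.1.at x)) (p.1.at x) +
    frob (compliance Emax Emin E₀ (χ x) (p.2.at x)) (p.2.at x))

/-- `L(χ, σ, ϱ) = J̃(χ, σ, ϱ) + lam (g̃(χ, σ, ϱ) - min_S g̃(χ, ·))`.  The minimum is written as an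
infimum. -/
def penalty {d : ℕ} {Ω : Set (Space d)} (Emax Emin : ℝ) (E₀ : symMat d ≃ₗ[ℝ] symMat d) (lam : ℝ)
    (S : Set (TensorField Ω × TensorField Ω)) (χ : L1 Ω)
    (p : TensorField Ω × TensorField Ω) : ℝ :=
  Jtilde Emax Emin E₀ χ p + lam * (gtilde Emax Emin E₀ χ p - sInf (gtilde Emax Emin E₀ χ '' S))

/-- The set of minimizers of `f` over `s`. -/
def argminOn {α : Type*} (f : α → ℝ) (s : Set α) : Set α := {p | p ∈ s ∧ IsMinOn f s p}

/-- The feasible set of the bilevel problem: admissible densities with a stress pair that minimizes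
`g̃(χ, ·)` over `S`. -/
def bilevelFeasible {d : ℕ} {Ω : Set (Space d)} (Emax Emin : ℝ) (E₀ : symMat d ≃ₗ[ℝ] symMat d)
    (U : Set (L1 Ω)) (S : Set (TensorField Ω × TensorField Ω)) :
    Set (L1 Ω × (TensorField Ω × TensorField Ω)) :=
  {z | z.1 ∈ U ∧ z.2 ∈ argminOn (gtilde Emax Emin E₀ z.1) S}

end Mechanism

end

/-! For fixed `χ`, let `a(σ,τ) = ∫ c E₀⁻¹σ : τ` be the energy form with weight `c = (1/Emax -
1/Emin) χ + 1/Emin`. Then `J̃ = a(σ,ϱ)` and `g̃ = a(σ,σ) + a(ϱ,ϱ)`. Both components of `S` are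
affine sets over one linear space `V = homStress Ω Γ`, since they prescribe normal traces on the
same part of the boundary. The form `a` is coercive on the closed space `V`, so Lax–Milgram
(`exists_add_mem_orthogonal`) moves any admissible field to one that is `a`-orthogonal to `V`.

Let `(σ*, ϱ*)` be the resulting pair and perturb it by `(h, k) ∈ V × V`. Orthogonality removes all
terms linear in `h` or `k`, also from `J̃`, because `V` is common to both. Hence `L` changes by
exactly `a(h,k) + λ (a(h,h) + a(k,k))`. Since `|a(h,k)| ≤ (a(h,h) + a(k,k)) / 2`, this is positive
for `λ > 1/2` unless `h = k = 0`. So `g̃` and `L` have the same unique minimizer, where the penalty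
term vanishes (`argminOn_form_eq_singleton`, `exists_argminOn_eq_singleton`).

For the joint problem, any pair that is not optimal for its density lies strictly above the optimal
pair with the same density. This exactness alone identifies minimizers and infima of the two
problems (`argminOn_eq_of_exact_penalty`, `isGLB_image_iff_of_exact_penalty`). -/

noncomputable section

namespace Mechanism

/-! ### Quadratic functionals on products of affine spaces. -/

section Abstract

variable {X : Type*} [AddCommGroup X] [Module ℝ X]

/-- The energy of a perturbation in an orthogonal direction splits. -/
theorem form_add_self {a : LinearMap.BilinForm ℝ X} (hsymm : ∀ x y, a x y = a y x) {x h : X}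
    (hx : a x h = 0) : a (x + h) (x + h) = a x x + a h h := by
  have := hsymm h x
  simp only [map_add, LinearMap.add_apply]
  linarith

/-- Used with `k` and `-k`, this bounds `|a h k|` and produces the threshold `1/2`. Nonnegativity is
asked only at `h + k`, because the form is known to be positive only on a subspace. -/
theorem neg_half_le_form {a : LinearMap.BilinForm ℝ X} (hsymm : ∀ x y, a x y = a y x) {h k : X}
    (hpos : 0 ≤ a (h + k) (h + k)) : -(1 / 2) * (a h h + a k k) ≤ a h k := by
  have := hsymm k h
  simp only [map_add, LinearMap.add_apply] at hpos
  linarith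

/-- A pair of quadratic minimization problems over translates of a subspace `V`. -/
theorem argminOn_form_eq_singleton {a : LinearMap.BilinForm ℝ X} (hsymm : ∀ x y, a x y = a y x)
    {V : Submodule ℝ X} (hpos : ∀ h ∈ V, h ≠ 0 → 0 < a h h) {A B : Set X} {x y : X}
    (hA : ∀ σ, σ ∈ A ↔ σ - x ∈ V) (hB : ∀ σ, σ ∈ B ↔ σ - y ∈ V)
    (hx : ∀ v ∈ V, a x v = 0) (hy : ∀ v ∈ V, a y v = 0) {f : X × X → ℝ} {κ μ b : ℝ}
    (hμ : 1 / 2 * |κ| < μ)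
    (hf : ∀ p, f p = κ * a p.1 p.2 + μ * (a p.1 p.1 + a p.2 p.2) - b) :
    argminOn f (A ×ˢ B) = {(x, y)} := by
  have hnn : ∀ h ∈ V, 0 ≤ a h h := fun h hh => by
    by_cases h0 : h = 0
    · simp [h0]
    · exact (hpos h hh h0).le
  have hlt : ∀ p ∈ A ×ˢ B, p ≠ (x, y) → f (x, y) < f p := by
    rintro ⟨σ, τ⟩ ⟨h1, h2⟩ hne
    obtain ⟨h, rfl⟩ : ∃ h, σ = x + h := ⟨σ - x, by abel⟩
    obtain ⟨k, rfl⟩ : ∃ k, τ = y + k := ⟨τ - y, by abel⟩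
    replace h1 : h ∈ V := by simpa using (hA _).1 h1
    replace h2 : k ∈ V := by simpa using (hB _).1 h2
    have e1 := form_add_self hsymm (hx h h1)
    have e2 := form_add_self hsymm (hy k h2)
    have e3 : a (x + h) (y + k) = a x y + a h k := by
      -- Each base point is tested with the perturbation of the other one; this is where the common
      -- direction space `V` matters.
      have q1 := hx k h2
      have q2 := hy h h1
      rw [hsymm] at q2
      simp only [map_add, LinearMap.add_apply]
      linarith
    have i1 := neg_half_le_form hsymm (hnn _ (V.add_mem h1 h2))
    have i2 := neg_half_le_form hsymm (hnn _ (V.add_mem h1 (V.neg_mem h2)))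
    simp only [map_neg, LinearMap.neg_apply, neg_neg] at i2
    have hs : 0 < a h h + a k k := by
      by_cases h0 : h = 0
      · have k0 : k ≠ 0 := by
          rintro rfl
          exact hne (by simp [h0])
        exact add_pos_of_nonneg_of_pos (hnn h h1) (hpos k h2 k0)
      · exact add_pos_of_pos_of_nonneg (hpos h h1 h0) (hnn k h2)
    have hab : |a h k| ≤ 1 / 2 * (a h h + a k k) := abs_le.2 ⟨by linarith, by linarith⟩
    have hk : -(|κ| * (1 / 2 * (a h h + a k k))) ≤ κ * a h k := by
      refine neg_le_of_abs_le ?_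
      rw [abs_mul]
      gcongr
    have hmul : 1 / 2 * |κ| * (a h h + a k k) < μ * (a h h + a k k) := by gcongr
    rw [hf, hf]
    simp only [e1, e2, e3]
    linarith
  have hmem : (x, y) ∈ A ×ˢ B := ⟨(hA x).2 (by simp), (hB y).2 (by simp)⟩
  ext p
  constructor
  · rintro ⟨hp, hmin⟩
    by_contra hne
    exact absurd (hmin hmem) (not_le.2 (hlt p hp hne))
  · rintro rfl
    refine ⟨hmem, fun p hp => ?_⟩
    change f (x, y) ≤ f p
    by_cases hne : p = (x, y)
    · rw [hne]
    · exact (hlt p hp hne).le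

end Abstract

/-- The Euler-Lagrange equation of a coercive form on a closed subspace of a Hilbert space. -/
theorem exists_add_mem_orthogonal {H : Type*} [NormedAddCommGroup H] [InnerProductSpace ℝ H]
    [CompleteSpace H] (a : H →L[ℝ] H →L[ℝ] ℝ) (V : Submodule ℝ H) (hV : IsClosed (V : Set H))
    {C : ℝ} (hC : 0 < C) (hcoer : ∀ v ∈ V, C * ‖v‖ ^ 2 ≤ a v v) (x : H) :
    ∃ h ∈ V, ∀ v ∈ V, a (x + h) v = 0 := by
  have : CompleteSpace V := hV.completeSpace_coe
  let aV : V →L[ℝ] V →L[ℝ] ℝ := a.bilinearComp V.subtypeL V.subtypeL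
  -- Lax–Milgram on `V`: `f` represents `a x` restricted to `V`, and `h` solves `a h v = a x v`
  -- there, so `-h` is the correction.
  have hco : IsCoercive aV := ⟨C, hC, fun u => by
    simpa [aV, pow_two, mul_assoc] using hcoer u u.2⟩
  let f : V := (InnerProductSpace.toDual ℝ V).symm ((a x).comp V.subtypeL)
  let h : V := hco.continuousLinearEquivOfBilin.symm f
  refine ⟨-h, V.neg_mem h.2, fun v hv => ?_⟩
  have h1 : aV h ⟨v, hv⟩ = a x v := by
    rw [← hco.continuousLinearEquivOfBilin_apply h ⟨v, hv⟩]
    simp [h, f]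
  have h2 : a h v = a x v := h1
  simp [h2]

/-! ### Exact penalization in the abstract. -/

section Bilevel

variable {α β : Type*}

/-- Abstract form of the equivalence of an exact penalization with the bilevel problem: `P` is the penalized
objective, which coincides with `J` on the feasible set `F` and lies strictly above some feasible
value elsewhere. -/
theorem argminOn_eq_of_exact_penalty {P J : α → ℝ} {T F : Set α} (hFT : F ⊆ T)
    (hF : ∀ z ∈ F, P z = J z) (hlt : ∀ z ∈ T, z ∉ F → ∃ z' ∈ F, J z' < P z) :
    argminOn P T = argminOn J F := by
  ext z
  constructor
  · rintro ⟨hz, hmin⟩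
    have hzF : z ∈ F := by
      by_contra hzF
      obtain ⟨z', h', h''⟩ := hlt z hz hzF
      have : P z ≤ P z' := hmin (hFT h')
      rw [hF z' h'] at this
      linarith
    refine ⟨hzF, fun y hy => ?_⟩
    have : P z ≤ P y := hmin (hFT hy)
    rwa [hF z hzF, hF y hy] at this
  · rintro ⟨hz, hmin⟩
    refine ⟨hFT hz, fun y hy => ?_⟩
    change P z ≤ P y
    rw [hF z hz]
    by_cases hyF : y ∈ F
    · rw [hF y hyF]
      exact hmin hyF
    · obtain ⟨z', h', h''⟩ := hlt y hy hyF
      have : J z ≤ J z' := hmin h'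
      linarith

/-- The two sets of values have the same lower bounds, so no minimizer of either problem has to
exist. -/
theorem isGLB_image_iff_of_exact_penalty {P J : α → ℝ} {T F : Set α} (hFT : F ⊆ T)
    (hF : ∀ z ∈ F, P z = J z) (hlt : ∀ z ∈ T, z ∉ F → ∃ z' ∈ F, J z' < P z) (m : ℝ) :
    IsGLB (P '' T) m ↔ IsGLB (J '' F) m := by
  have : lowerBounds (P '' T) = lowerBounds (J '' F) := by
    ext b
    simp only [mem_lowerBounds, forall_mem_image]
    constructor
    · intro h z hz
      rw [← hF z hz]
      exact h (hFT hz)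
    · intro h z hz
      by_cases hzF : z ∈ F
      · rw [hF z hzF]
        exact h hzF
      · obtain ⟨z', h', h''⟩ := hlt z hz hzF
        exact (h h').trans h''.le
  rw [IsGLB, IsGLB, this]

end Bilevel

/-! ### Algebra and coercivity of the compliance tensor on matrices. -/

section Compliance

variable {d : ℕ}

theorem frob_comm (A B : Matrix (Fin d) (Fin d) ℝ) : frob A B = frob B A := by
  simp only [frob, mul_comm]

/-- The antisymmetric part of `B` is Frobenius-orthogonal to symmetric matrices. -/
theorem frob_symPart {A : Matrix (Fin d) (Fin d) ℝ} (hA : A.IsSymm)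
    (B : Matrix (Fin d) (Fin d) ℝ) : frob A (symPart B).1 = frob A B := by
  have h : ∑ i, ∑ j, A i j * B j i = ∑ i, ∑ j, A i j * B i j := by
    rw [Finset.sum_comm]
    simp only [hA.apply]
  simp only [frob, symPart, Matrix.smul_apply, Matrix.add_apply, Matrix.transpose_apply,
    smul_eq_mul]
  have : ∀ i j, A i j * (1 / 2 * (B i j + B j i)) = 1 / 2 * (A i j * B i j) +
      1 / 2 * (A i j * B j i) := fun i j => by ring
  simp only [this, Finset.sum_add_distrib, ← Finset.mul_sum, h]
  ring

/-- `symPart` as a linear map. -/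
def symPartₗ (d : ℕ) : Matrix (Fin d) (Fin d) ℝ →ₗ[ℝ] symMat d where
  toFun := symPart
  map_add' A B := by
    ext i j
    simp only [symPart, Submodule.coe_add, Matrix.smul_apply, Matrix.add_apply,
      Matrix.transpose_apply, smul_eq_mul]
    ring
  map_smul' c A := by
    ext i j
    simp only [symPart, Submodule.coe_smul, Matrix.smul_apply, Matrix.add_apply,
      Matrix.transpose_apply, smul_eq_mul, RingHom.id_apply]
    ring

/-- The entries of the compliance tensor `E₀⁻¹`. -/
def complianceEntry (E₀ : symMat d ≃ₗ[ℝ] symMat d) (i j k l : Fin d) : ℝ :=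
  (E₀.symm (symPart (Matrix.single k l 1))).1 i j

/-- Coordinates turn the energy product into a finite sum of monomials, from which continuity,
integrability and the bounded bilinear form are read off. -/
theorem symm_symPart_apply (E₀ : symMat d ≃ₗ[ℝ] symMat d) (M : Matrix (Fin d) (Fin d) ℝ)
    (i j : Fin d) :
    (E₀.symm (symPart M)).1 i j = ∑ k, ∑ l, complianceEntry E₀ i j k l * M k l := by
  let f : Matrix (Fin d) (Fin d) ℝ →ₗ[ℝ] ℝ :=
    (Matrix.entryLinearMap ℝ ℝ i j) ∘ₗ (symMat d).subtype ∘ₗ E₀.symm.toLinearMap ∘ₗ symPartₗ d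
  change f M = ∑ k, ∑ l, f (Matrix.single k l 1) * M k l
  conv_lhs => rw [Matrix.matrix_eq_sum_single M]
  simp only [map_sum]
  refine Finset.sum_congr rfl fun k _ => Finset.sum_congr rfl fun l _ => ?_
  rw [show Matrix.single k l (M k l) = M k l • Matrix.single k l (1 : ℝ) by
    rw [Matrix.smul_single, smul_eq_mul, mul_one], map_smul, smul_eq_mul, mul_comm]

/-- The energy product `E₀⁻¹ M : N`. -/
def energyProd (E₀ : symMat d ≃ₗ[ℝ] symMat d) (M N : Matrix (Fin d) (Fin d) ℝ) : ℝ :=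
  frob (E₀.symm (symPart M)).1 N

theorem energyProd_eq_sum (E₀ : symMat d ≃ₗ[ℝ] symMat d) (M N : Matrix (Fin d) (Fin d) ℝ) :
    energyProd E₀ M N = ∑ i, ∑ j, ∑ k, ∑ l, complianceEntry E₀ i j k l * (M k l * N i j) := by
  simp only [energyProd, frob, symm_symPart_apply, Finset.sum_mul, mul_assoc]

theorem frob_compliance (Emax Emin : ℝ) (E₀ : symMat d ≃ₗ[ℝ] symMat d) (c : ℝ)
    (M N : Matrix (Fin d) (Fin d) ℝ) :
    frob (compliance Emax Emin E₀ c M) N =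
      ((1 / Emax - 1 / Emin) * c + 1 / Emin) * energyProd E₀ M N := by
  simp only [energyProd, frob, compliance, Finset.mul_sum, Matrix.smul_apply, smul_eq_mul,
    mul_assoc]

/-- This is the symmetry of `E₀` evaluated at `E₀⁻¹ M` and `E₀⁻¹ N`. -/
theorem energyProd_comm {E₀ : symMat d ≃ₗ[ℝ] symMat d} (hE₀ : IsElasticityTensor E₀)
    (M N : Matrix (Fin d) (Fin d) ℝ) : energyProd E₀ M N = energyProd E₀ N M := by
  have h := hE₀.1 (E₀.symm (symPart M)) (E₀.symm (symPart N))
  rw [E₀.apply_symm_apply, E₀.apply_symm_apply, frob_comm,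
    frob_symPart (E₀.symm (symPart N)).2, frob_symPart (E₀.symm (symPart M)).2] at h
  exact h.symm

theorem energyProd_self_pos {E₀ : symMat d ≃ₗ[ℝ] symMat d} (hE₀ : IsElasticityTensor E₀)
    {M : Matrix (Fin d) (Fin d) ℝ} (hM : M.IsSymm) (h0 : M ≠ 0) : 0 < energyProd E₀ M M := by
  have hne : E₀.symm (symPart M) ≠ 0 := by
    intro h
    apply h0
    rw [← symPart_of_isSymm hM, (LinearEquiv.map_eq_zero_iff _).1 h]
    rfl
  have h := hE₀.2 _ hne
  rwa [E₀.apply_symm_apply, symPart_of_isSymm hM, frob_comm] at h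

/-- The energy product is coercive on symmetric matrices. -/
theorem exists_energyProd_coercive {E₀ : symMat d ≃ₗ[ℝ] symMat d} (hE₀ : IsElasticityTensor E₀) :
    ∃ α : ℝ, 0 < α ∧ ∀ M : Matrix (Fin d) (Fin d) ℝ, M.IsSymm →
      α * frob M M ≤ energyProd E₀ M M := by
  let toMat : EuclideanSpace ℝ (Fin d × Fin d) → Matrix (Fin d) (Fin d) ℝ :=
    fun u => Matrix.of fun i j => u (i, j)
  have hfrob : ∀ u, frob (toMat u) (toMat u) = ‖u‖ ^ 2 := fun u => by
    rw [EuclideanSpace.real_norm_sq_eq, Fintype.sum_prod_type]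
    simp [frob, toMat, pow_two]
  have hsmul : ∀ (c : ℝ) u, energyProd E₀ (toMat (c • u)) (toMat (c • u)) =
      c ^ 2 * energyProd E₀ (toMat u) (toMat u) := fun c u => by
    simp only [energyProd_eq_sum, Finset.mul_sum, toMat, Matrix.of_apply, PiLp.smul_apply,
      smul_eq_mul]
    refine Finset.sum_congr rfl fun i _ => Finset.sum_congr rfl fun j _ =>
      Finset.sum_congr rfl fun k _ => Finset.sum_congr rfl fun l _ => ?_
    ring
  -- The coercivity constant is the minimum of the energy over the compact unit sphere of symmetric
  -- matrices; homogeneity of degree two extends the bound.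
  let K : Set (EuclideanSpace ℝ (Fin d × Fin d)) :=
    Metric.sphere 0 1 ∩ {u | ∀ i j, u (i, j) = u (j, i)}
  have hK : IsCompact K := by
    refine (isCompact_sphere 0 1).inter_right ?_
    simp only [ofPred_forall]
    exact isClosed_iInter fun i => isClosed_iInter fun j =>
      isClosed_eq (by fun_prop) (by fun_prop)
  have hcont : Continuous fun u => energyProd E₀ (toMat u) (toMat u) := by
    simp only [energyProd_eq_sum, toMat, Matrix.of_apply]
    fun_prop
  obtain ⟨α, hα, hle⟩ : ∃ α : ℝ, 0 < α ∧ ∀ u ∈ K, α ≤ energyProd E₀ (toMat u) (toMat u) := by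
    rcases K.eq_empty_or_nonempty with h | h
    -- The sphere is empty when `d = 0`, and any positive constant serves.
    · exact ⟨1, one_pos, by simp [h]⟩
    · obtain ⟨u, hu, hmin⟩ := hK.exists_isMinOn h hcont.continuousOn
      refine ⟨_, energyProd_self_pos hE₀ (M := toMat u) ?_ ?_, fun v hv => hmin hv⟩
      · ext i j
        exact hu.2 j i
      · intro h0
        have := hfrob u
        rw [h0, mem_sphere_zero_iff_norm.1 hu.1] at this
        simp [frob] at this
  refine ⟨α, hα, fun M hM => ?_⟩
  let u : EuclideanSpace ℝ (Fin d × Fin d) := WithLp.toLp 2 fun p => M p.1 p.2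
  have hu : toMat u = M := rfl
  rw [← hu, hfrob]
  by_cases h0 : u = 0
  · have : energyProd E₀ (toMat u) (toMat u) = 0 := by
      simpa [h0] using hsmul 0 0
    rw [this, h0]
    simp
  · have hn : ‖u‖ ≠ 0 := norm_ne_zero_iff.2 h0
    have hmem : ‖u‖⁻¹ • u ∈ K := by
      refine ⟨by simp [norm_smul, hn], fun i j => ?_⟩
      have : M i j = M j i := hM.apply j i
      simp [u, this]
    have := hle _ hmem
    rw [hsmul, inv_pow, inv_mul_eq_div, le_div_iff₀ (by positivity)] at this
    exact this

end Compliance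

/-! ### Admissible stresses as an affine space. -/

section Stress

variable {d : ℕ} {Ω : Set (Space d)}

theorem inner_L2 (u v : L2 Ω) : inner ℝ u v = ∫ x in Ω, v x * u x := by
  simp [MeasureTheory.L2.inner_def]

theorem integrable_mul_L2 (u v : L2 Ω) :
    Integrable (fun x => u x * v x) (volume.restrict Ω) :=
  (Lp.memLp u).integrable_mul (Lp.memLp v)

theorem memLp_partialDeriv {φ : Space d → ℝ} (hφ : IsTestFunction Ω φ) (j : Fin d) :
    MemLp (partialDeriv j φ) 2 (volume.restrict Ω) := by
  have hc : Continuous (partialDeriv j φ) :=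
    (hφ.1.continuous_fderiv (by simp)).clm_apply continuous_const
  have hs : HasCompactSupport (partialDeriv j φ) :=
    hφ.2.1.fderiv_apply ℝ (EuclideanSpace.single j 1)
  exact (hc.memLp_of_hasCompactSupport hs).restrict Ω

theorem sum_inner_L2 {ι : Type*} [Fintype ι] (g u : ι → L2 Ω) :
    ∑ j, inner ℝ (g j) (u j) = ∫ x in Ω, ∑ j, u j x * g j x := by
  rw [integral_finsetSum _ fun j _ => integrable_mul_L2 _ _]
  exact Finset.sum_congr rfl fun j _ => inner_L2 _ _

/-- The product `∫_Ω σ : G` of tensor fields, as a functional of `σ`. -/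
def tensorPair (G : TensorField Ω) : TensorField Ω →ₗ[ℝ] ℝ where
  toFun σ := ∑ i, ∑ j, inner ℝ (G i j) (σ i j)
  map_add' σ τ := by simp [inner_add_right, Finset.sum_add_distrib]
  map_smul' c σ := by simp [inner_smul_right, Finset.mul_sum]

theorem tensorPair_apply (G σ : TensorField Ω) :
    tensorPair G σ = ∫ x in Ω, ∑ i, ∑ j, σ i j x * G i j x := by
  have h := sum_inner_L2 (fun p : Fin d × Fin d => G p.1 p.2) fun p => σ p.1 p.2
  simp only [Fintype.sum_prod_type] at h
  exact h

/-- The product `∫_Ω ∑ⱼ σᵢⱼ gⱼ` of a row of a tensor field with a vector field. -/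
def rowPair (i : Fin d) (g : Fin d → L2 Ω) : TensorField Ω →ₗ[ℝ] ℝ where
  toFun σ := ∑ j, inner ℝ (g j) (σ i j)
  map_add' σ τ := by simp [inner_add_right, Finset.sum_add_distrib]
  map_smul' c σ := by simp [inner_smul_right, Finset.mul_sum]

theorem rowPair_apply (i : Fin d) {g : Fin d → Space d → ℝ}
    (hg : ∀ j, MemLp (g j) 2 (volume.restrict Ω)) (σ : TensorField Ω) :
    rowPair i (fun j => (hg j).toLp) σ = ∫ x in Ω, ∑ j, σ i j x * g j x := by
  refine (sum_inner_L2 _ (σ i)).trans (integral_congr_ae ?_)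
  filter_upwards [eventually_all.2 fun j => (hg j).coeFn_toLp] with x hx
  exact Finset.sum_congr rfl fun j _ => congrArg (σ i j x * ·) (hx j)

theorem integral_zero_field_mul (Φ : Fin d → Space d → ℝ) :
    ∫ x in Ω, ∑ i, (0 : Fin d → L2 Ω) i x * Φ i x = 0 := by
  refine integral_eq_zero_of_ae ?_
  filter_upwards [Lp.coeFn_zero ℝ 2 ((volume : Measure (Space d)).restrict Ω)] with x hx
  exact Finset.sum_eq_zero fun i _ => mul_eq_zero_of_left hx _

/-- Written this way, the constraint is the vanishing of a family of linear functionals of `σ`, each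
an `L²` inner product with a fixed field; hence it is linear and closed. -/
theorem hasWeakDivergence_zero_iff (σ : TensorField Ω) :
    HasWeakDivergence Ω σ 0 ↔ ∀ (φ : Space d → ℝ) (hφ : IsTestFunction Ω φ) (i : Fin d),
      rowPair i (fun j => (memLp_partialDeriv hφ j).toLp) σ = 0 := by
  refine forall_congr' fun φ => forall_congr' fun hφ => forall_congr' fun i => ?_
  have h0 : ∫ x in Ω, (0 : Fin d → L2 Ω) i x * φ x = 0 := by
    refine integral_eq_zero_of_ae ?_
    filter_upwards [Lp.coeFn_zero ℝ 2 ((volume : Measure (Space d)).restrict Ω)] with x hx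
    exact mul_eq_zero_of_left hx _
  rw [rowPair_apply, h0, neg_zero]

/-- Gradients of the vector fields in `H¹(Ω)^d` with trace `t` that vanishes outside `Γ`. -/
def IsTestGradient (Γ : Set (Space d)) (G : TensorField Ω) (t : Fin d → L2Boundary Ω) : Prop :=
  ∃ w : Fin d → L2 Ω, (∀ i, HasWeakGradient Ω (w i) (G i)) ∧
    (∀ i, HasTrace Ω (w i) (G i) (t i)) ∧ ∀ i, ∀ᵐ x ∂(surface Ω), x ∉ Γ → t i x = 0

theorem hasNormalTraceOn_zero_iff (Γ : Set (Space d)) (σ : TensorField Ω) (q : Traction Ω Γ) :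
    HasNormalTraceOn Ω Γ σ 0 q ↔ ∀ (G : TensorField Ω) (t : Fin d → L2Boundary Ω),
      IsTestGradient Γ G t → tensorPair G σ = ∫ x in Γ, ∑ i, q i x * t i x ∂(surface Ω) := by
  constructor
  · rintro h G t ⟨w, h1, h2, h3⟩
    have := h w G t h1 h2 h3
    rwa [integral_zero_field_mul fun i => w i, add_zero, ← tensorPair_apply] at this
  · intro h w G t h1 h2 h3
    rw [integral_zero_field_mul fun i => w i, add_zero]
    exact (tensorPair_apply G σ).symm.trans (h G t ⟨w, h1, h2, h3⟩)

/-- Symmetric, divergence free stress fields whose normal trace on `Γ` vanishes. -/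
def homStress (Ω Γ : Set (Space d)) : Submodule ℝ (TensorField Ω) where
  carrier := {σ | (∀ i j, σ i j = σ j i) ∧
    (∀ (φ : Space d → ℝ) (hφ : IsTestFunction Ω φ) (i : Fin d),
      rowPair i (fun j => (memLp_partialDeriv hφ j).toLp) σ = 0) ∧
    ∀ (G : TensorField Ω) (t : Fin d → L2Boundary Ω), IsTestGradient Γ G t → tensorPair G σ = 0}
  add_mem' {σ τ} hσ hτ := by
    refine ⟨fun i j => ?_, fun φ hφ i => ?_, fun G t h => ?_⟩
    · rw [Matrix.add_apply, Matrix.add_apply, hσ.1 i j, hτ.1 i j]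
    · rw [map_add, hσ.2.1 φ hφ i, hτ.2.1 φ hφ i, add_zero]
    · rw [map_add, hσ.2.2 G t h, hτ.2.2 G t h, add_zero]
  zero_mem' := ⟨fun i j => rfl, fun φ hφ i => map_zero _, fun G t h => map_zero _⟩
  smul_mem' c σ hσ := by
    refine ⟨fun i j => ?_, fun φ hφ i => ?_, fun G t h => ?_⟩
    · rw [Matrix.smul_apply, Matrix.smul_apply, hσ.1 i j]
    · rw [map_smul, hσ.2.1 φ hφ i, smul_zero]
    · rw [map_smul, hσ.2.2 G t h, smul_zero]

/-- Every constraint is linear in `σ` with a right-hand side independent of `σ`, so subtracting a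
particular solution leaves the homogeneous constraints. The resulting space does not depend on `q`.
-/
theorem mem_stressSet_iff_sub_mem {Γ : Set (Space d)} {q : Traction Ω Γ} {σ₀ : TensorField Ω}
    (h₀ : σ₀ ∈ stressSet Ω Γ q) (σ : TensorField Ω) :
    σ ∈ stressSet Ω Γ q ↔ σ - σ₀ ∈ homStress Ω Γ := by
  obtain ⟨a1, a2, a3⟩ := h₀
  rw [hasWeakDivergence_zero_iff] at a2
  rw [hasNormalTraceOn_zero_iff] at a3
  change (_ ∧ HasWeakDivergence Ω σ 0 ∧ HasNormalTraceOn Ω Γ σ 0 q) ↔ _ ∧ _ ∧ _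
  rw [hasWeakDivergence_zero_iff, hasNormalTraceOn_zero_iff]
  refine and_congr ?_ (and_congr ?_ ?_)
  · refine forall_congr' fun i => forall_congr' fun j => ?_
    rw [Matrix.sub_apply, Matrix.sub_apply, a1 i j, sub_left_inj]
  · refine forall_congr' fun φ => forall_congr' fun hφ => forall_congr' fun i => ?_
    rw [map_sub, a2 φ hφ i, sub_zero]
  · refine forall_congr' fun G => forall_congr' fun t => forall_congr' fun h => ?_
    rw [map_sub, a3 G t h, sub_eq_zero]

end Stress

/-! ### The weighted energy form on the Hilbert space of tensor fields. -/

section Energy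

variable {d : ℕ} {Ω : Set (Space d)}

/-- The product `∫_Ω c u v` of functions in `L²(Ω)` with a bounded weight `c`. -/
def weightedPair (c : Lp ℝ ⊤ ((volume : Measure (Space d)).restrict Ω)) :
    L2 Ω →L[ℝ] L2 Ω →L[ℝ] ℝ :=
  ((ContinuousLinearMap.mul ℝ ℝ).lpPairing (volume.restrict Ω) 2 2).comp
    ((ContinuousLinearMap.mul ℝ ℝ).holderL (volume.restrict Ω) ⊤ 2 2 c)

theorem weightedPair_apply {c : Space d → ℝ} (hc : MemLp c ⊤ (volume.restrict Ω)) (u v : L2 Ω) :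
    weightedPair hc.toLp u v = ∫ x in Ω, c x * (u x * v x) := by
  rw [weightedPair, ContinuousLinearMap.comp_apply, ContinuousLinearMap.lpPairing_eq_integral]
  refine integral_congr_ae ?_
  filter_upwards [(ContinuousLinearMap.mul ℝ ℝ).coeFn_holder (r := 2) hc.toLp u, hc.coeFn_toLp]
    with x hx hx'
  have : ((ContinuousLinearMap.mul ℝ ℝ).holderL (volume.restrict Ω) ⊤ 2 2 hc.toLp u) x =
      c x * u x := by
    rw [← hx']
    exact hx
  simp only [ContinuousLinearMap.mul_apply', this, mul_assoc]

theorem integrable_weighted {c : Space d → ℝ} (hc : MemLp c ⊤ (volume.restrict Ω)) (u v : L2 Ω) :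
    Integrable (fun x => c x * (u x * v x)) (volume.restrict Ω) :=
  (integrable_mul_L2 u v).mul_of_top_right hc

/-- The Hilbert space of tensor fields. -/
abbrev TensorHilbert (Ω : Set (Space d)) : Type := PiLp 2 fun _ : Fin d × Fin d => L2 Ω

/-- The tensor field with the given entries. -/
def toTensor (Ω : Set (Space d)) : TensorHilbert Ω ≃ₗ[ℝ] TensorField Ω where
  toFun u := fun i j => u (i, j)
  invFun σ := WithLp.toLp 2 fun p => σ p.1 p.2
  map_add' _ _ := rfl
  map_smul' _ _ := rfl
  left_inv _ := rfl
  right_inv _ := rfl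

theorem toTensor_apply (u : TensorHilbert Ω) (i j : Fin d) : toTensor Ω u i j = u (i, j) := rfl

/-- An intersection of equality sets of continuous maps. Closedness supplies the completeness that
Lax–Milgram needs. -/
theorem isClosed_comap_homStress (Ω Γ : Set (Space d)) :
    IsClosed ((homStress Ω Γ).comap (toTensor Ω).toLinearMap : Set (TensorHilbert Ω)) := by
  have hset : ((homStress Ω Γ).comap (toTensor Ω).toLinearMap : Set (TensorHilbert Ω)) =
      {u | ∀ i j, u (i, j) = u (j, i)} ∩
      ({u | ∀ (φ : Space d → ℝ) (hφ : IsTestFunction Ω φ) (i : Fin d),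
        ∑ j, inner ℝ ((memLp_partialDeriv hφ j).toLp) (u (i, j)) = 0} ∩
      {u | ∀ (G : TensorField Ω) (t : Fin d → L2Boundary Ω), IsTestGradient Γ G t →
        ∑ i, ∑ j, inner ℝ (G i j) (u (i, j)) = 0}) := rfl
  rw [hset]
  simp only [ofPred_forall]
  refine IsClosed.inter ?_ (IsClosed.inter ?_ ?_)
  · exact isClosed_iInter fun i => isClosed_iInter fun j => isClosed_eq (by fun_prop) (by fun_prop)
  · exact isClosed_iInter fun φ => isClosed_iInter fun hφ => isClosed_iInter fun i =>
      isClosed_eq (by fun_prop) continuous_const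
  · exact isClosed_iInter fun G => isClosed_iInter fun t => isClosed_iInter fun h =>
      isClosed_eq (by fun_prop) continuous_const

/-- The energy form `∫_Ω c E₀⁻¹ σ : τ` on the Hilbert space of tensor fields. -/
def energyFormL (E₀ : symMat d ≃ₗ[ℝ] symMat d)
    (c : Lp ℝ ⊤ ((volume : Measure (Space d)).restrict Ω)) :
    TensorHilbert Ω →L[ℝ] TensorHilbert Ω →L[ℝ] ℝ :=
  ∑ i, ∑ j, ∑ k, ∑ l, complianceEntry E₀ i j k l • (weightedPair c).bilinearComp
    (PiLp.proj 2 (fun _ : Fin d × Fin d => L2 Ω) (k, l))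
    (PiLp.proj 2 (fun _ : Fin d × Fin d => L2 Ω) (i, j))

theorem integrable_energy (E₀ : symMat d ≃ₗ[ℝ] symMat d) {c : Space d → ℝ}
    (hc : MemLp c ⊤ (volume.restrict Ω)) (σ τ : TensorField Ω) :
    Integrable (fun x => c x * energyProd E₀ (σ.at x) (τ.at x)) (volume.restrict Ω) := by
  simp only [energyProd_eq_sum, Finset.mul_sum]
  refine integrable_finsetSum _ fun i _ => integrable_finsetSum _ fun j _ =>
    integrable_finsetSum _ fun k _ => integrable_finsetSum _ fun l _ => ?_
  exact ((integrable_weighted hc (σ k l) (τ i j)).const_mul (complianceEntry E₀ i j k l)).congr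
    (.of_forall fun x => mul_left_comm _ _ _)

theorem energyFormL_apply (E₀ : symMat d ≃ₗ[ℝ] symMat d) {c : Space d → ℝ}
    (hc : MemLp c ⊤ (volume.restrict Ω)) (u v : TensorHilbert Ω) :
    energyFormL E₀ hc.toLp u v =
      ∫ x in Ω, c x * energyProd E₀ ((toTensor Ω u).at x) ((toTensor Ω v).at x) := by
  have hint : ∀ i j k l, Integrable (fun x => complianceEntry E₀ i j k l *
      (c x * (u (k, l) x * v (i, j) x))) (volume.restrict Ω) := fun i j k l =>
    (integrable_weighted hc _ _).const_mul _
  have hfun : ∀ x, c x * energyProd E₀ ((toTensor Ω u).at x) ((toTensor Ω v).at x) =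
      ∑ i, ∑ j, ∑ k, ∑ l, complianceEntry E₀ i j k l * (c x * (u (k, l) x * v (i, j) x)) := by
    intro x
    simp only [energyProd_eq_sum, Finset.mul_sum, TensorField.at, toTensor_apply]
    refine Finset.sum_congr rfl fun i _ => Finset.sum_congr rfl fun j _ =>
      Finset.sum_congr rfl fun k _ => Finset.sum_congr rfl fun l _ => ?_
    ring
  simp only [hfun]
  rw [integral_finsetSum _ fun i _ => integrable_finsetSum _ fun j _ =>
    integrable_finsetSum _ fun k _ => integrable_finsetSum _ fun l _ => hint i j k l]
  simp only [energyFormL, sum_apply]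
  refine Finset.sum_congr rfl fun i _ => ?_
  rw [integral_finsetSum _ fun j _ =>
    integrable_finsetSum _ fun k _ => integrable_finsetSum _ fun l _ => hint i j k l]
  refine Finset.sum_congr rfl fun j _ => ?_
  rw [integral_finsetSum _ fun k _ => integrable_finsetSum _ fun l _ => hint i j k l]
  refine Finset.sum_congr rfl fun k _ => ?_
  rw [integral_finsetSum _ fun l _ => hint i j k l]
  refine Finset.sum_congr rfl fun l _ => ?_
  rw [integral_const_mul, ← weightedPair_apply hc]
  rfl

/-- The `PiLp 2` norm is the integrated Frobenius norm, so the pointwise coercivity of the energy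
product integrates to coercivity of the form. -/
theorem norm_sq_eq_integral_frob (u : TensorHilbert Ω) :
    ‖u‖ ^ 2 = ∫ x in Ω, frob ((toTensor Ω u).at x) ((toTensor Ω u).at x) := by
  rw [← real_inner_self_eq_norm_sq, PiLp.inner_apply, Fintype.sum_prod_type]
  exact tensorPair_apply (toTensor Ω u) (toTensor Ω u)

theorem integrable_frob (σ : TensorField Ω) :
    Integrable (fun x => frob (σ.at x) (σ.at x)) (volume.restrict Ω) :=
  integrable_finsetSum _ fun _ _ => integrable_finsetSum _ fun _ _ => integrable_mul_L2 _ _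

theorem frob_self_nonneg (M : Matrix (Fin d) (Fin d) ℝ) : 0 ≤ frob M M :=
  Finset.sum_nonneg fun _ _ => Finset.sum_nonneg fun _ _ => mul_self_nonneg _

theorem TensorField.isSymm_at {σ : TensorField Ω} (hσ : ∀ i j, σ i j = σ j i) (x : Space d) :
    (σ.at x).IsSymm := by
  ext i j
  simp only [Matrix.transpose_apply, TensorField.at, hσ j i]

/-- The energy form is coercive on symmetric tensor fields. -/
theorem exists_energyFormL_coercive {E₀ : symMat d ≃ₗ[ℝ] symMat d} (hE₀ : IsElasticityTensor E₀)
    {c : Space d → ℝ} (hc : MemLp c ⊤ (volume.restrict Ω)) {c₀ : ℝ} (hc₀ : 0 < c₀)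
    (hle : ∀ᵐ x ∂volume.restrict Ω, c₀ ≤ c x) :
    ∃ C : ℝ, 0 < C ∧ ∀ u : TensorHilbert Ω, (∀ i j, u (i, j) = u (j, i)) →
      C * ‖u‖ ^ 2 ≤ energyFormL E₀ hc.toLp u u := by
  obtain ⟨α, hα, hcoer⟩ := exists_energyProd_coercive hE₀
  refine ⟨c₀ * α, mul_pos hc₀ hα, fun u hu => ?_⟩
  rw [energyFormL_apply, norm_sq_eq_integral_frob, ← integral_const_mul]
  refine integral_mono_ae ((integrable_frob _).const_mul _) (integrable_energy E₀ hc _ _) ?_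
  filter_upwards [hle] with x hx
  have h1 := hcoer _ (TensorField.isSymm_at (σ := toTensor Ω u) hu x)
  have h2 := frob_self_nonneg ((toTensor Ω u).at x)
  calc c₀ * α * frob ((toTensor Ω u).at x) ((toTensor Ω u).at x)
      = c₀ * (α * frob ((toTensor Ω u).at x) ((toTensor Ω u).at x)) := mul_assoc _ _ _
    _ ≤ c x * energyProd E₀ ((toTensor Ω u).at x) ((toTensor Ω u).at x) := by
      have := mul_nonneg hα.le h2
      gcongr
      exact hc₀.le.trans hx

/-- The energy form on tensor fields. -/
def energyForm (E₀ : symMat d ≃ₗ[ℝ] symMat d)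
    (c : Lp ℝ ⊤ ((volume : Measure (Space d)).restrict Ω)) :
    LinearMap.BilinForm ℝ (TensorField Ω) :=
  LinearMap.mk₂ ℝ (fun σ τ => energyFormL E₀ c ((toTensor Ω).symm σ) ((toTensor Ω).symm τ))
    (by simp) (by simp) (by simp) (by simp)

theorem energyForm_apply (E₀ : symMat d ≃ₗ[ℝ] symMat d) {c : Space d → ℝ}
    (hc : MemLp c ⊤ (volume.restrict Ω)) (σ τ : TensorField Ω) :
    energyForm E₀ hc.toLp σ τ = ∫ x in Ω, c x * energyProd E₀ (σ.at x) (τ.at x) := by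
  simp [energyForm, energyFormL_apply]

theorem energyForm_comm {E₀ : symMat d ≃ₗ[ℝ] symMat d} (hE₀ : IsElasticityTensor E₀)
    {c : Space d → ℝ} (hc : MemLp c ⊤ (volume.restrict Ω)) (σ τ : TensorField Ω) :
    energyForm E₀ hc.toLp σ τ = energyForm E₀ hc.toLp τ σ := by
  simp only [energyForm_apply, energyProd_comm hE₀]

/-- The weight `(1/E_max - 1/E_min) χ + 1/E_min`. -/
def stiffnessWeight (Emax Emin : ℝ) (χ : L1 Ω) (x : Space d) : ℝ :=
  (1 / Emax - 1 / Emin) * χ x + 1 / Emin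

theorem stiffnessWeight_mem {Emax Emin : ℝ} {χ : L1 Ω}
    (hχ : ∀ᵐ x ∂(volume.restrict Ω), χ x = 0 ∨ χ x = 1) :
    ∀ᵐ x ∂(volume.restrict Ω), stiffnessWeight Emax Emin χ x = 1 / Emin ∨
      stiffnessWeight Emax Emin χ x = 1 / Emax := by
  filter_upwards [hχ] with x hx
  rcases hx with hx | hx <;> simp [stiffnessWeight, hx]

/-- Elements of `L1 Ω` need not be bounded; the weight is, because `χ` takes only two values. -/
theorem memLp_top_stiffnessWeight {Emax Emin : ℝ} {χ : L1 Ω}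
    (hχ : ∀ᵐ x ∂(volume.restrict Ω), χ x = 0 ∨ χ x = 1) :
    MemLp (stiffnessWeight Emax Emin χ) ⊤ (volume.restrict Ω) := by
  refine memLp_top_of_bound
    (((Lp.aestronglyMeasurable χ).const_mul _).add aestronglyMeasurable_const)
    (max |1 / Emin| |1 / Emax|) ?_
  filter_upwards [stiffnessWeight_mem hχ] with x hx
  rcases hx with hx | hx <;> rw [hx]
  · exact le_max_left _ _
  · exact le_max_right _ _

theorem Jtilde_eq {Emax Emin : ℝ} (E₀ : symMat d ≃ₗ[ℝ] symMat d) {χ : L1 Ω}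
    (hc : MemLp (stiffnessWeight Emax Emin χ) ⊤ (volume.restrict Ω))
    (p : TensorField Ω × TensorField Ω) :
    Jtilde Emax Emin E₀ χ p = energyForm E₀ hc.toLp p.1 p.2 := by
  simp only [Jtilde, frob_compliance, energyForm_apply, stiffnessWeight]

theorem gtilde_eq {Emax Emin : ℝ} (E₀ : symMat d ≃ₗ[ℝ] symMat d) {χ : L1 Ω}
    (hc : MemLp (stiffnessWeight Emax Emin χ) ⊤ (volume.restrict Ω))
    (p : TensorField Ω × TensorField Ω) :
    gtilde Emax Emin E₀ χ p =
      energyForm E₀ hc.toLp p.1 p.1 + energyForm E₀ hc.toLp p.2 p.2 := by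
  rw [energyForm_apply, energyForm_apply,
    ← integral_add (integrable_energy E₀ hc _ _) (integrable_energy E₀ hc _ _)]
  simp only [gtilde, frob_compliance, stiffnessWeight]

end Energy

/-! ### Lower level and penalized problems for a fixed density. -/

section Penalty

variable {d : ℕ} {Ω Γ : Set (Space d)} {Emax Emin lam : ℝ} {E₀ : symMat d ≃ₗ[ℝ] symMat d}
  {χ : L1 Ω}

/-- For a fixed density, the lower level problem and the penalized problem have the same unique
solution. -/
theorem exists_argminOn_eq_singleton (hEmax : 0 < Emax) (hEmin : 0 < Emin)
    (hE₀ : IsElasticityTensor E₀) (hlam : 1 / 2 < lam)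
    (hχ : ∀ᵐ x ∂(volume.restrict Ω), χ x = 0 ∨ χ x = 1) {qin qout : Traction Ω Γ}
    (hne : (stressPairs Ω Γ qin qout).Nonempty) :
    ∃ p, argminOn (gtilde Emax Emin E₀ χ) (stressPairs Ω Γ qin qout) = {p} ∧
      argminOn (penalty Emax Emin E₀ lam (stressPairs Ω Γ qin qout) χ)
        (stressPairs Ω Γ qin qout) = {p} := by
  have hc := memLp_top_stiffnessWeight (Emax := Emax) (Emin := Emin) hχ
  -- The minimum of both values is needed because `Emin` and `Emax` are not assumed ordered.
  have hle : ∀ᵐ x ∂volume.restrict Ω,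
      min (1 / Emin) (1 / Emax) ≤ stiffnessWeight Emax Emin χ x := by
    filter_upwards [stiffnessWeight_mem hχ] with x hx
    rcases hx with hx | hx <;> rw [hx]
    · exact min_le_left _ _
    · exact min_le_right _ _
  obtain ⟨C, hC, hcoer⟩ := exists_energyFormL_coercive hE₀ hc
    (lt_min (one_div_pos.2 hEmin) (one_div_pos.2 hEmax)) hle
  have hpos : ∀ h ∈ homStress Ω Γ, h ≠ 0 → 0 < energyForm E₀ hc.toLp h h := fun h hh h0 => by
    have hn : 0 < ‖(toTensor Ω).symm h‖ :=
      norm_pos_iff.2 ((LinearEquiv.map_ne_zero_iff _).2 h0)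
    exact (mul_pos hC (pow_pos hn 2)).trans_le (hcoer ((toTensor Ω).symm h) hh.1)
  -- Any admissible field can be corrected within `homStress` to one that is energy-orthogonal to
  -- it; this is then the base point of the affine set.
  have hsol : ∀ q : Traction Ω Γ, (stressSet Ω Γ q).Nonempty → ∃ σ,
      (∀ τ, τ ∈ stressSet Ω Γ q ↔ τ - σ ∈ homStress Ω Γ) ∧
        ∀ v ∈ homStress Ω Γ, energyForm E₀ hc.toLp σ v = 0 := by
    rintro q ⟨σ₀, hσ₀⟩
    obtain ⟨h, hh, horth⟩ := exists_add_mem_orthogonal (energyFormL E₀ hc.toLp) _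
      (isClosed_comap_homStress Ω Γ) hC (fun v hv => hcoer v hv.1) ((toTensor Ω).symm σ₀)
    have hmem : σ₀ + toTensor Ω h ∈ stressSet Ω Γ q :=
      (mem_stressSet_iff_sub_mem hσ₀ _).2 (by simpa using hh)
    refine ⟨σ₀ + toTensor Ω h, mem_stressSet_iff_sub_mem hmem, fun v hv => ?_⟩
    have := horth ((toTensor Ω).symm v) (by simpa using hv)
    simpa [energyForm] using this
  obtain ⟨p₀, hin, hout⟩ := hne
  obtain ⟨σ, hσ, hσ'⟩ := hsol qin ⟨_, hin⟩
  obtain ⟨τ, hτ, hτ'⟩ := hsol qout ⟨_, hout⟩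
  refine ⟨(σ, τ), ?_, ?_⟩
  · refine argminOn_form_eq_singleton (energyForm_comm hE₀ hc) hpos hσ hτ hσ' hτ'
      (κ := 0) (μ := 1) (b := 0) (by norm_num) fun p => ?_
    rw [gtilde_eq E₀ hc]
    ring
  -- The coefficient `κ = 1` comes from `J̃`, so the condition `|κ| / 2 < μ` is exactly `1 / 2 <
  -- lam`. The infimum enters only through the constant `b`, which does not affect minimizers.
  · refine argminOn_form_eq_singleton (energyForm_comm hE₀ hc) hpos hσ hτ hσ' hτ'
      (κ := 1) (μ := lam)
      (b := lam * sInf (gtilde Emax Emin E₀ χ '' stressPairs Ω Γ qin qout))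
      (by simpa using hlam) fun p => ?_
    rw [penalty, gtilde_eq E₀ hc p, Jtilde_eq E₀ hc]
    ring

/-- At a lower-level minimizer the infimum is attained, so the penalty term is zero. -/
theorem penalty_eq_Jtilde_of_mem_argminOn {S : Set (TensorField Ω × TensorField Ω)}
    {p : TensorField Ω × TensorField Ω} (hp : p ∈ argminOn (gtilde Emax Emin E₀ χ) S) :
    penalty Emax Emin E₀ lam S χ p = Jtilde Emax Emin E₀ χ p := by
  have : IsLeast (gtilde Emax Emin E₀ χ '' S) (gtilde Emax Emin E₀ χ p) :=
    ⟨mem_image_of_mem _ hp.1, by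
      rintro _ ⟨y, hy, rfl⟩
      exact hp.2 hy⟩
  rw [penalty, this.csInf_eq, sub_self, mul_zero, add_zero]

end Penalty

end Mechanism

end

/-! ### Assembly of the equivalence. -/

theorem mainTheorem3 {d : ℕ} (Ω : Set (Mechanism.Space d)) (hΩ : Mechanism.IsLipschitzDomain Ω)
    (ΓD ΓN : Set (Mechanism.Space d)) (hΓD : MeasurableSet ΓD) (hΓN : MeasurableSet ΓN)
    (hcover : frontier Ω = closure ΓD ∪ closure ΓN) (hdisj : ΓD ∩ ΓN = ∅)
    (qin qout : Mechanism.Traction Ω ΓN)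
    (Emax Emin : ℝ) (hEmax : 0 < Emax) (hEmin : 0 < Emin)
    (E₀ : Mechanism.symMat d ≃ₗ[ℝ] Mechanism.symMat d) (hE₀ : Mechanism.IsElasticityTensor E₀)
    (β : ℝ) (hβ₀ : 0 < β) (hβ₁ : β < 1) (lam : ℝ) (hlam : 1 / 2 < lam)
    (S : Set (Mechanism.TensorField Ω × Mechanism.TensorField Ω))
    (hS : S = Mechanism.stressPairs Ω ΓN qin qout)
    (U : Set (Mechanism.L1 Ω)) (hU : U = Mechanism.designs Ω β) :
    -- for each fixed admissible density
    (∀ χ ∈ U,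
      -- the lower level problem has exactly one solution (as soon as it has an admissible pair)
      (S.Nonempty → ∃! p, p ∈ Mechanism.argminOn (Mechanism.gtilde Emax Emin E₀ χ) S) ∧
      -- the minimum of the penalized functional is attained exactly there, with value `J̃`
      (∀ p ∈ Mechanism.argminOn (Mechanism.gtilde Emax Emin E₀ χ) S,
        IsLeast (Mechanism.penalty Emax Emin E₀ lam S χ '' S) (Mechanism.Jtilde Emax Emin E₀ χ p) ∧
        Mechanism.argminOn (Mechanism.penalty Emax Emin E₀ lam S χ) S = {p})) ∧
    -- the penalized problem and the bilevel problem have the same solutions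
    Mechanism.argminOn (fun z => Mechanism.penalty Emax Emin E₀ lam S z.1 z.2) (U ×ˢ S) =
      Mechanism.argminOn (fun z => Mechanism.Jtilde Emax Emin E₀ z.1 z.2)
        (Mechanism.bilevelFeasible Emax Emin E₀ U S) ∧
    -- and the same optimal value
    (∀ m : ℝ, IsGLB ((fun z : Mechanism.L1 Ω × (Mechanism.TensorField Ω × Mechanism.TensorField Ω) =>
        Mechanism.penalty Emax Emin E₀ lam S z.1 z.2) '' (U ×ˢ S)) m ↔
      IsGLB ((fun z : Mechanism.L1 Ω × (Mechanism.TensorField Ω × Mechanism.TensorField Ω) =>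
        Mechanism.Jtilde Emax Emin E₀ z.1 z.2) ''
          (Mechanism.bilevelFeasible Emax Emin E₀ U S)) m) := by

  subst hS hU
  have key : ∀ χ ∈ Mechanism.designs Ω β,
      (Mechanism.stressPairs Ω ΓN qin qout).Nonempty → ∃ p,
        Mechanism.argminOn (Mechanism.gtilde Emax Emin E₀ χ)
          (Mechanism.stressPairs Ω ΓN qin qout) = {p} ∧
        Mechanism.argminOn (Mechanism.penalty Emax Emin E₀ lam
          (Mechanism.stressPairs Ω ΓN qin qout) χ) (Mechanism.stressPairs Ω ΓN qin qout) = {p} :=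
    fun χ hχ hne => Mechanism.exists_argminOn_eq_singleton hEmax hEmin hE₀ hlam hχ.2.1 hne
  have hFT : Mechanism.bilevelFeasible Emax Emin E₀ (Mechanism.designs Ω β)
      (Mechanism.stressPairs Ω ΓN qin qout) ⊆
      Mechanism.designs Ω β ×ˢ Mechanism.stressPairs Ω ΓN qin qout :=
    fun z hz => ⟨hz.1, hz.2.1⟩
  have hF : ∀ z ∈ Mechanism.bilevelFeasible Emax Emin E₀ (Mechanism.designs Ω β)
      (Mechanism.stressPairs Ω ΓN qin qout),
      Mechanism.penalty Emax Emin E₀ lam (Mechanism.stressPairs Ω ΓN qin qout) z.1 z.2 =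
        Mechanism.Jtilde Emax Emin E₀ z.1 z.2 :=
    fun z hz => Mechanism.penalty_eq_Jtilde_of_mem_argminOn hz.2
  have hlt : ∀ z ∈ Mechanism.designs Ω β ×ˢ Mechanism.stressPairs Ω ΓN qin qout,
      z ∉ Mechanism.bilevelFeasible Emax Emin E₀ (Mechanism.designs Ω β)
        (Mechanism.stressPairs Ω ΓN qin qout) →
      ∃ z' ∈ Mechanism.bilevelFeasible Emax Emin E₀ (Mechanism.designs Ω β)
        (Mechanism.stressPairs Ω ΓN qin qout),
        Mechanism.Jtilde Emax Emin E₀ z'.1 z'.2 <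
        Mechanism.penalty Emax Emin E₀ lam (Mechanism.stressPairs Ω ΓN qin qout) z.1 z.2 := by
    rintro ⟨χ, r⟩ ⟨hχ, hr⟩ hz
    obtain ⟨p, h1, h2⟩ := key χ hχ ⟨r, hr⟩
    have hp1 : p ∈ Mechanism.argminOn _ _ := h1 ▸ mem_singleton p
    have hp2 : p ∈ Mechanism.argminOn _ _ := h2 ▸ mem_singleton p
    -- The comparison point keeps the density. If `L` at `r` did not exceed `L` at `p`, then `r`
    -- would also minimize `L`, hence `g̃`, since both have the same argmin; this contradicts the
    -- infeasibility of `(χ, r)`.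
    refine ⟨(χ, p), ⟨hχ, hp1⟩, ?_⟩
    rw [← Mechanism.penalty_eq_Jtilde_of_mem_argminOn (lam := lam) hp1]
    refine lt_of_not_ge fun hle => hz ⟨hχ, ?_⟩
    have hr2 : r ∈ Mechanism.argminOn (Mechanism.penalty Emax Emin E₀ lam
        (Mechanism.stressPairs Ω ΓN qin qout) χ) (Mechanism.stressPairs Ω ΓN qin qout) :=
      ⟨hr, fun y hy => le_trans hle (hp2.2 hy)⟩
    rwa [h1, ← h2]
  refine ⟨fun χ hχ => ⟨fun hne => ?_, fun p hp => ?_⟩,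
    Mechanism.argminOn_eq_of_exact_penalty hFT hF hlt,
    Mechanism.isGLB_image_iff_of_exact_penalty hFT hF hlt⟩
  · obtain ⟨p, h1, -⟩ := key χ hχ hne
    rw [h1]
    exact ⟨p, rfl, fun _ h => h⟩
  · obtain ⟨p', h1, h2⟩ := key χ hχ ⟨p, hp.1⟩
    obtain rfl : p = p' := by rwa [h1] at hp
    refine ⟨?_, h2⟩
    have hp2 : p ∈ Mechanism.argminOn _ _ := h2 ▸ mem_singleton p
    rw [← Mechanism.penalty_eq_Jtilde_of_mem_argminOn (lam := lam) hp]
    refine ⟨mem_image_of_mem _ hp.1, ?_⟩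
    rintro _ ⟨y, hy, rfl⟩
    exact hp2.2 hy
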